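/- **Setting.** Let $\Gamma$ be a totally ordered abelian group and $F$ a field with a valuation $\nu:F^\times\to\Gamma$ with ring of integers $\mathcal O$, residue map $x\mapsto\overline{x}$ from $\mathcal O$ onto the residue field $\overline F$, and a homomorphism $t:\Gamma\to F^\times$ with $\nu\circ t=\mathrm{id}_\Gamma$. Assume that $\overline F$ is a local field (a field with a nontrivial absolute value for which it is locally compact), with a fixed Haar measure; $\overline F^{\,n}$ carries the product measure, and on $\overline F$ we write $|\cdot|$ for the normalised absolute value, i.e. the factor by which multiplication scales Haar measure. Let $\mathbb C(\Gamma)$ be the field of fractions of the complex group algebra of $\Gamma$, whose basis elements are written $X^\gamma$. For $\alpha\in F^\times$ put $|\alpha|=|\overline{\alpha\,t(-\nu(\alpha))}|\,X^{\nu(\alpha)}\in\mathbb C(\Gamma)$. **Lifts.** For $g:\overline F^{\,n}\to\mathbb C$, $a\in F^n$, $\gamma\in\Gamma^n$, the lift $g^{a,\gamma}:F^n\to\mathbb C$ is $$g^{a,\gamma}(x)=g\bigl(\overline{(x_1-a_1)t(-\gamma_1)},\dots,\overline{(x_n-a_n)t(-\gamma_n)}\bigr)$$ if $x_i\in a_i+t(\gamma_i)\mathcal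 O$ for all $i$, and $g^{a,\gamma}(x)=0$ otherwise. **The integral on $F$.** A function $F\to\mathbb C(\Gamma)$ is *simple* if it is of the form $g^{a,\gamma}X^\delta$ with $g:\overline F\to\mathbb C$ Haar integrable, $a\in F$, $\gamma,\delta\in\Gamma$; it is *integrable* if it lies in the $\mathbb C(\Gamma)$-span $\mathcal L(F)$ of the simple functions. $\int^F$ denotes the unique $\mathbb C(\Gamma)$-linear functional on $\mathcal L(F)$ such that $\int^F g^{0,0}(x)\,dx=\int_{\overline F}g(u)\,du$ for $g$ Haar integrable, $\int^F f(x+a)\,dx=\int^F f(x)\,dx$ for $a\in F$, and $\int^F f(\alpha x)\,dx=|\alpha|^{-1}\int^F f(x)\,dx$ for $\alpha\in F^\times$. **Fubini functions on $F^n$** ($n\ge 1$). A function $f:F\to\mathbb C(\Gamma)$ is *Fubini* if it is integrable, and its repeated integral is $\int^F f(x)\,dx$; it is *strongly Fubini* if it is simple. For $n>1$, $f:F^n\to\mathbb C(\Gamma)$ is Fubini if for each $r$ all the functions $x_r\mapsto f(x_1,\dots,x_n)$ (the other variables being fixed) are integrable, the partial integral $\int^F f(x_1,\dots,x_n)\,dx_r$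 is a Fubini function on $F^{n-1}$ of the other variables, and the repeated integral of this partial integral does not depend on $r$; its common value is the repeated integral $\int^{F^n}f(x)\,dx$. For $n>1$, $f$ is strongly Fubini if it is Fubini and for each $r$ all the functions $x_r\mapsto f(x_1,\dots,x_n)$ are simple and the partial integral $\int^F f(x_1,\dots,x_n)\,dx_r$ is strongly Fubini on $F^{n-1}$. **GL-Fubini functions on $\overline F^{\,n}$.** A function $g:\overline F^{\,n}\to\mathbb C$ is *Fubini* if it is Haar integrable and, when $n>1$, for each $r$ all the functions $u_r\mapsto g(u_1,\dots,u_n)$ are Haar integrable on $\overline F$ and the everywhere defined function $\int g(u_1,\dots,u_n)\,du_r$ is Fubini on $\overline F^{\,n-1}$. It is *GL-Fubini* if $u\mapsto g(\sigma u)$ is Fubini for every $\sigma\in\mathrm{GL}_n(\overline F)$. **Proposition.** Let $n\ge1$, let $g$ be GL-Fubini on $\overline F^{\,n}$, $a\in F^n$, $\gamma\in\Gamma^n$, $\delta\in\Gamma$, and set $f=g^{a,\gamma}X^\delta$. Let $\tau\in\mathrm{GL}_n(F)$. Then $f\circ\tau:x\mapsto f(\tau x)$ is strongly Fubini on $F^n$,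 and $$\int^{F^n}f(\tau x)\,dx=|\det\tau|^{-1}\int^{F^n}f(x)\,dx .$$ -/

import Mathlib

open MeasureTheory

noncomputable section

/-- The ring of integers `{x | 0 ≤ ν x}` of an additively written valuation. -/
def ringOfIntegers {F Γ : Type*} [Field F] [AddCommGroup Γ] [LinearOrder Γ] [IsOrderedAddMonoid Γ]
    (ν : AddValuation F (WithTop Γ)) : Subring F where
  carrier := {x | 0 ≤ ν x}
  mul_mem' {a b} ha hb := by
    simp only [Set.mem_ofPred_eq] at *
    rw [ν.map_mul]
    exact add_nonneg ha hb
  one_mem' := by simp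
  add_mem' {a b} ha hb := le_trans (le_min ha hb) (ν.map_add a b)
  zero_mem' := by simp
  neg_mem' {a} ha := by simpa using ha

/-- A field `F` with a valuation `ν : Fˣ → Γ` (with `ν 0 = ⊤`), split by a homomorphism
`t : Γ → Fˣ`, and with residue field `k`: a field onto which the ring of integers surjects by the
residue map `ρ`.  (As `k` is a field, the kernel of `ρ` is the maximal ideal.) -/
structure SplitValuedField (F Γ k : Type*) [Field F] [AddCommGroup Γ] [LinearOrder Γ]
    [IsOrderedAddMonoid Γ] [Field k] where
  ν : AddValuation F (WithTop Γ)
  t : Multiplicative Γ →* Fˣ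
  ν_t : ∀ γ : Γ, ν (t (Multiplicative.ofAdd γ) : F) = (γ : WithTop Γ)
  ρ : ringOfIntegers ν →+* k
  ρ_surjective : Function.Surjective ρ

/-- `ℂ(Γ)`: the field of fractions of the complex group algebra of `Γ`. -/
abbrev CGamma (Γ : Type*) [AddCommGroup Γ] : Type _ :=
  FractionRing (AddMonoidAlgebra ℂ Γ)

/-- The basis element `X^γ`, in `ℂ(Γ)`. -/
def Xpow {Γ : Type*} [AddCommGroup Γ] (γ : Γ) : CGamma Γ :=
  algebraMap (AddMonoidAlgebra ℂ Γ) (CGamma Γ) (AddMonoidAlgebra.single γ 1)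

/-- A complex number, in `ℂ(Γ)`. -/
def constC (Γ : Type*) [AddCommGroup Γ] (z : ℂ) : CGamma Γ :=
  algebraMap (AddMonoidAlgebra ℂ Γ) (CGamma Γ) (AddMonoidAlgebra.single 0 z)

/-- The normalised absolute value of a locally compact field: the factor by which multiplication
by `x` scales Haar measure (`0` at `x = 0`). -/
def modulus {k : Type*} [NontriviallyNormedField k] [LocallyCompactSpace k] (x : k) : ℝ :=
  open Classical in
  if h : x = 0 then 0 else (distribHaarChar k (Units.mk0 x h) : ℝ)

/-- Fubini functions on `kⁿ`: Haar integrable functions all of whose iterated partial integrals are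
defined everywhere.  That the repeated integrals in different orders agree is Fubini's theorem, so
it is not required.  Every function on the point `k⁰` is accepted, so that for `n = 1` the
condition is Haar integrability. -/
def ResFubini {k : Type*} [MeasurableSpace k] (μ : Measure k) :
    (n : ℕ) → ((Fin n → k) → ℂ) → Prop
  | 0, _ => True
  | n + 1, g =>
    Integrable g (Measure.pi fun _ : Fin (n + 1) => μ) ∧
      ∀ r : Fin (n + 1),
        (∀ y : Fin n → k, Integrable (fun u : k => g (r.insertNth u y)) μ) ∧
          ResFubini μ n (fun y : Fin n → k => ∫ u, g (r.insertNth u y) ∂μ)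

/-- `g` on `kⁿ` is GL-Fubini if `g ∘ σ` is Fubini for all `σ ∈ GLₙ(k)`. -/
def GLFubini {k : Type*} [Field k] [MeasurableSpace k] (μ : Measure k) (n : ℕ)
    (g : (Fin n → k) → ℂ) : Prop :=
  ∀ σ : GL (Fin n) k, ResFubini μ n (fun u => g ((σ : Matrix (Fin n) (Fin n) k).mulVec u))

namespace SplitValuedField

section Algebra

variable {F Γ k : Type*} [Field F] [AddCommGroup Γ] [LinearOrder Γ] [IsOrderedAddMonoid Γ]
  [Field k] (V : SplitValuedField F Γ k)

/-- `t(γ)` as an element of `F`. -/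
def tF (γ : Γ) : F := (V.t (Multiplicative.ofAdd γ) : F)

/-- The residue map, extended by `0` outside the ring of integers. -/
def res (x : F) : k :=
  open Classical in if h : x ∈ ringOfIntegers V.ν then V.ρ ⟨x, h⟩ else 0

/-- The valuation of a non-zero element, as an element of `Γ` (`0` at `x = 0`). -/
def ord (x : F) : Γ := (V.ν x).untopD 0

/-- The lift `g^{a,γ}` to `F` of a function `g` on `k`; note that `x ∈ a + t(γ)𝒪` if and only if
`(x - a)t(-γ) ∈ 𝒪`. -/
def lift₁ (g : k → ℂ) (a : F) (γ : Γ) (x : F) : ℂ :=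
  open Classical in
  if (x - a) * V.tF (-γ) ∈ ringOfIntegers V.ν then g (V.res ((x - a) * V.tF (-γ))) else 0

/-- The lift `g^{a,γ}` to `Fⁿ` of a function `g` on `kⁿ`. -/
def lift {n : ℕ} (g : (Fin n → k) → ℂ) (a : Fin n → F) (γ : Fin n → Γ) (x : Fin n → F) : ℂ :=
  open Classical in
  if ∀ i, (x i - a i) * V.tF (-γ i) ∈ ringOfIntegers V.ν then
    g (fun i => V.res ((x i - a i) * V.tF (-γ i)))
  else 0

end Algebra

variable {F Γ k : Type*} [Field F] [AddCommGroup Γ] [LinearOrder Γ] [IsOrderedAddMonoid Γ]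
  [NontriviallyNormedField k] [LocallyCompactSpace k] [MeasurableSpace k]
  (V : SplitValuedField F Γ k) (μ : Measure k)

/-- The `ℂ(Γ)`-valued absolute value `|α| = |residue of α t(-ν(α))| X^{ν(α)}` on `F`. -/
def absF {F Γ k : Type*} [Field F] [AddCommGroup Γ] [LinearOrder Γ] [IsOrderedAddMonoid Γ]
    [NontriviallyNormedField k] [LocallyCompactSpace k] (V : SplitValuedField F Γ k) (α : F) :
    CGamma Γ :=
  constC Γ (modulus (V.res (α * V.tF (-V.ord α))) : ℂ) * Xpow (V.ord α)

/-- Simple functions on `F`: those of the form `g^{a,γ} X^δ` with `g` Haar integrable on `k`. -/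
def IsSimple (f : F → CGamma Γ) : Prop :=
  ∃ g : k → ℂ, Integrable g μ ∧
    ∃ (a : F) (γ δ : Γ), f = fun x => constC Γ (V.lift₁ g a γ x) * Xpow δ

/-- The space of integrable functions on `F`: the `ℂ(Γ)`-span of the simple functions. -/
def integrableSpace : Submodule (CGamma Γ) (F → CGamma Γ) :=
  Submodule.span (CGamma Γ) {f | V.IsSimple μ f}

/-- The three properties that characterise the integral on `F`: it lifts the Haar integral on `k`,
is invariant under translation, and is compatible with the multiplicative structure. -/
def IsIntegralFunctional (I : V.integrableSpace μ →ₗ[CGamma Γ] CGamma Γ) : Prop :=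
  (∀ g : k → ℂ, Integrable g μ → ∀ f : V.integrableSpace μ,
    (∀ x, f.1 x = constC Γ (V.lift₁ g 0 0 x)) → I f = constC Γ (∫ u, g u ∂μ)) ∧
  (∀ (f f' : V.integrableSpace μ) (a : F), (∀ x, f'.1 x = f.1 (x + a)) → I f' = I f) ∧
  (∀ (f f' : V.integrableSpace μ) (α : F), α ≠ 0 → (∀ x, f'.1 x = f.1 (α * x)) →
    I f' = (V.absF α)⁻¹ * I f)

/-- The integral on `F`, as the (unique) linear functional with the three properties. -/
def integralFunctional : V.integrableSpace μ →ₗ[CGamma Γ] CGamma Γ :=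
  Classical.epsilon (V.IsIntegralFunctional μ)

/-- The integral on `F` of a function (`0` if the function is not integrable). -/
def integral (f : F → CGamma Γ) : CGamma Γ :=
  open Classical in
  if h : f ∈ V.integrableSpace μ then V.integralFunctional μ ⟨f, h⟩ else 0

/-- The function `(x₁, …, x̂ᵣ, …, xₙ₊₁) ↦ ∫ f(x₁, …, xₙ₊₁) dxᵣ`. -/
def partialIntegral {n : ℕ} (r : Fin (n + 1)) (f : (Fin (n + 1) → F) → CGamma Γ) :
    (Fin n → F) → CGamma Γ :=
  fun y => V.integral μ (fun x => f (r.insertNth x y))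

/-- The repeated integral: the value at the point for `n = 0`, and then integrate out one variable
at a time.  For Fubini functions the order of the variables does not matter. -/
def repeatedIntegral : (n : ℕ) → ((Fin n → F) → CGamma Γ) → CGamma Γ
  | 0, f => f Fin.elim0
  | n + 1, f => repeatedIntegral n (V.partialIntegral μ 0 f)

/-- Fubini functions on `Fⁿ`.  The recursion starts at the point `F⁰`, where there is no condition,
so that for `n = 1` the condition is integrability on `F`. -/
def IsFubini : (n : ℕ) → ((Fin n → F) → CGamma Γ) → Prop
  | 0, _ => True
  | n + 1, f =>
    (∀ r : Fin (n + 1),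
      (∀ y : Fin n → F, (fun x : F => f (r.insertNth x y)) ∈ V.integrableSpace μ) ∧
        IsFubini n (V.partialIntegral μ r f)) ∧
    ∀ r s : Fin (n + 1),
      V.repeatedIntegral μ n (V.partialIntegral μ r f) =
        V.repeatedIntegral μ n (V.partialIntegral μ s f)

/-- Strongly Fubini functions on `Fⁿ`: Fubini functions whose one-variable sections are simple and
whose partial integrals are strongly Fubini.  Again there is no condition on the point `F⁰`, so that
for `n = 1` the condition is simplicity. -/
def IsStronglyFubini : (n : ℕ) → ((Fin n → F) → CGamma Γ) → Prop
  | 0, _ => True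
  | n + 1, f =>
    V.IsFubini μ (n + 1) f ∧
      ∀ r : Fin (n + 1),
        (∀ y : Fin n → F, V.IsSimple μ (fun x : F => f (r.insertNth x y))) ∧
          IsStronglyFubini n (V.partialIntegral μ r f)

theorem insertNth_fin_one {A : Type*} (r : Fin 1) (x : A) (y : Fin 0 → A) :
    (r.insertNth x y : Fin 1 → A) = fun _ => x := by
  funext i
  have h : i = r := by omega
  subst h
  simp

/-- In one variable, Fubini means integrable. -/
theorem isFubini_one (f : (Fin 1 → F) → CGamma Γ) :
    V.IsFubini μ 1 f ↔ (fun x : F => f (fun _ => x)) ∈ V.integrableSpace μ := by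
  constructor
  · intro h
    simpa only [insertNth_fin_one] using (h.1 0).1 Fin.elim0
  · intro h
    refine ⟨fun r => ⟨fun y => by simpa only [insertNth_fin_one] using h, trivial⟩, fun r s => ?_⟩
    have hrs : r = s := Subsingleton.elim (α := Fin 1) r s
    rw [hrs]

/-- In one variable, the repeated integral is the integral. -/
theorem repeatedIntegral_one (f : (Fin 1 → F) → CGamma Γ) :
    V.repeatedIntegral μ 1 f = V.integral μ (fun x : F => f (fun _ => x)) := by
  simp only [repeatedIntegral, partialIntegral, insertNth_fin_one]

/-- In one variable, strongly Fubini means simple. -/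
theorem isStronglyFubini_one (f : (Fin 1 → F) → CGamma Γ) :
    V.IsStronglyFubini μ 1 f ↔ V.IsSimple μ (fun x : F => f (fun _ => x)) := by
  constructor
  · intro h
    simpa only [insertNth_fin_one] using (h.2 0).1 Fin.elim0
  · intro h
    exact ⟨(V.isFubini_one μ f).2 (Submodule.subset_span h),
      fun r => ⟨fun y => by simpa only [insertNth_fin_one] using h, trivial⟩⟩

end SplitValuedField

end

/-! The change of variables is Gaussian elimination over the ring of integers. After absorbing $a$
and $\gamma$ into an affine map, the functions in play are $g^{0,0}(\tau x-b)X^\delta$. To integrate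
out $x_r$, choose in column $r$ of $\tau$ an entry of least valuation. The other entries of the
column are cleared by row operations with integral coefficients, and on residues these act as a
shear in $\mathrm{GL}_n(\overline F)$. So $g$ is replaced by $g$ composed with a shear, which is why
the Fubini property is demanded for all of $\mathrm{GL}_n(\overline F)$. Now $x_r$ enters one
coordinate only, and its integral is a one-variable affine substitution. The result is a function of
the same shape in one variable fewer, and $|\det\tau|^{-1}\int g\cdot X^\delta$ is unchanged in the
passage (`exists_partialIntegral_affineLift`). Induction gives the strong Fubini property and a
value independent of the order of integration.

All this presupposes that the integral on $F$ exists, i.e. that a vanishing combination of lifts has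
vanishing integral (`combinationIntegral_eq_zero`). Sampling a relation at one point per residue
class of a fixed ball separates the terms: larger balls contribute constants, smaller ones null
functions, and an integrable constant is zero because $\overline F$ has infinite measure. -/

noncomputable section

open scoped Pointwise

/-! ### Arithmetic in the coefficient field. -/

section CGamma

variable {Γ : Type*} [AddCommGroup Γ]

theorem Xpow_add (γ δ : Γ) : Xpow (γ + δ) = Xpow γ * Xpow δ := by
  simp [Xpow, ← map_mul, AddMonoidAlgebra.single_mul_single]

theorem Xpow_zero : Xpow (0 : Γ) = 1 := by
  rw [Xpow, ← AddMonoidAlgebra.one_def, map_one]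

theorem constC_mul (z w : ℂ) : constC Γ (z * w) = constC Γ z * constC Γ w := by
  simp [constC, ← map_mul, AddMonoidAlgebra.single_mul_single]

theorem constC_one : constC Γ 1 = 1 := by
  rw [constC, ← AddMonoidAlgebra.one_def, map_one]

theorem constC_zero : constC Γ 0 = 0 := by
  simp [constC]

theorem constC_eq_algebraMap (z : ℂ) : constC Γ z = algebraMap ℂ (CGamma Γ) z := by
  rw [constC, IsScalarTower.algebraMap_apply ℂ (AddMonoidAlgebra ℂ Γ) (CGamma Γ)]
  rfl

/-- Complex-linear functionals turn relations with coefficients in $\mathbb C(\Gamma)$ into complex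
relations, where measure theory applies. -/
theorem dual_mul_constC (l : Module.Dual ℂ (CGamma Γ)) (c : CGamma Γ) (z : ℂ) :
    l (c * constC Γ z) = l c * z := by
  rw [constC_eq_algebraMap, mul_comm, ← Algebra.smul_def, map_smul, smul_eq_mul, mul_comm]

variable [LinearOrder Γ] [IsOrderedAddMonoid Γ]

theorem Xpow_neg (γ : Γ) : Xpow (-γ) = (Xpow γ)⁻¹ := by
  apply eq_inv_of_mul_eq_one_left
  rw [← Xpow_add, neg_add_cancel, Xpow_zero]

theorem constC_inv (z : ℂ) : constC Γ z⁻¹ = (constC Γ z)⁻¹ := by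
  by_cases hz : z = 0
  · simp [hz, constC_zero]
  · apply eq_inv_of_mul_eq_one_left
    rw [← constC_mul, inv_mul_cancel₀ hz, constC_one]

end CGamma

/-! ### The normalised absolute value and scaling of Haar measure. -/

section Modulus

variable {k : Type*} [NontriviallyNormedField k] [LocallyCompactSpace k]

theorem modulus_of_ne_zero {x : k} (h : x ≠ 0) :
    modulus x = (distribHaarChar k (Units.mk0 x h) : ℝ) := by
  rw [modulus, dif_neg h]

theorem modulus_pos {x : k} (h : x ≠ 0) : 0 < modulus x := by
  rw [modulus_of_ne_zero h]
  exact_mod_cast distribHaarChar_pos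

theorem modulus_one : modulus (1 : k) = 1 := by
  rw [modulus_of_ne_zero one_ne_zero]
  simp

theorem modulus_mul (x y : k) : modulus (x * y) = modulus x * modulus y := by
  by_cases hx : x = 0
  · simp [hx, modulus]
  by_cases hy : y = 0
  · simp [hy, modulus]
  rw [modulus_of_ne_zero hx, modulus_of_ne_zero hy, modulus_of_ne_zero (mul_ne_zero hx hy),
    Units.mk0_mul, map_mul, NNReal.coe_mul]

theorem modulus_neg_one : modulus (-1 : k) = 1 := by
  have h : modulus (-1 : k) * modulus (-1 : k) = 1 := by
    rw [← modulus_mul]; simp [modulus_one]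
  have := modulus_pos (x := (-1 : k)) (by simp)
  -- A positive real number with square 1 is 1.
  nlinarith

theorem secondCountableTopology_of_locallyCompactSpace (k : Type*) [NontriviallyNormedField k]
    [LocallyCompactSpace k] : SecondCountableTopology k :=
  haveI := ProperSpace.of_locallyCompactSpace k (E := k)
  inferInstance

attribute [local instance] secondCountableTopology_of_locallyCompactSpace

variable [MeasurableSpace k] [BorelSpace k] (μ : Measure k) [μ.IsAddHaarMeasure]

theorem map_mul_left_eq_smul {c : k} (hc : c ≠ 0) :
    μ.map (c * ·) = ENNReal.ofReal (modulus c)⁻¹ • μ := by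
  ext s hs
  rw [Measure.map_apply (measurable_const_mul c) hs]
  have h := distribHaarChar_mul μ (Units.mk0 c hc) ((c * ·) ⁻¹' s)
  have h2 : (Units.mk0 c hc) • ((c * ·) ⁻¹' s) = s := by
    ext x
    rw [Set.mem_smul_set_iff_inv_smul_mem]
    simp [Units.smul_def, hc]
  rw [h2] at h
  have h3 : ENNReal.ofReal (modulus c) = (distribHaarChar k (Units.mk0 c hc) : ENNReal) := by
    rw [modulus_of_ne_zero hc, ENNReal.ofReal_coe_nnreal]
  rw [Measure.smul_apply, smul_eq_mul, ← h, ENNReal.ofReal_inv_of_pos (modulus_pos hc), ← h3,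
    ← mul_assoc, ENNReal.inv_mul_cancel, one_mul]
  · simpa using modulus_pos hc
  · simp

theorem integrable_comp_mul_left {g : k → ℂ} (hg : Integrable g μ) {c : k} (hc : c ≠ 0) :
    Integrable (fun u => g (c * u)) μ := by
  have h : Integrable g (μ.map (Homeomorph.mulLeft₀ c hc).toMeasurableEquiv) := by
    have : μ.map (Homeomorph.mulLeft₀ c hc).toMeasurableEquiv =
      ENNReal.ofReal (modulus c)⁻¹ • μ := map_mul_left_eq_smul μ hc
    rw [this]
    exact hg.smul_measure (by simp)
  exact (integrable_map_equiv _ _).1 h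

theorem integral_comp_mul_left {g : k → ℂ} {c : k} (hc : c ≠ 0) :
    ∫ u, g (c * u) ∂μ = ((modulus c : ℝ) : ℂ)⁻¹ * ∫ u, g u ∂μ := by
  have h := integral_map_equiv (μ := μ) (Homeomorph.mulLeft₀ c hc).toMeasurableEquiv g
  have : μ.map (Homeomorph.mulLeft₀ c hc).toMeasurableEquiv =
      ENNReal.ofReal (modulus c)⁻¹ • μ := map_mul_left_eq_smul μ hc
  rw [this, integral_smul_measure, ENNReal.toReal_ofReal (inv_nonneg.2 (modulus_pos hc).le)] at h
  rw [show ∫ u, g (c * u) ∂μ = _ from h.symm]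
  simp

end Modulus

/-! ### Valuation, residue map and absolute value of the split valued field. -/

namespace SplitValuedField

section Algebra

variable {F Γ k : Type*} [Field F] [AddCommGroup Γ] [LinearOrder Γ] [IsOrderedAddMonoid Γ]
  [Field k] (V : SplitValuedField F Γ k)

theorem mem_ringOfIntegers_iff {x : F} : x ∈ ringOfIntegers V.ν ↔ 0 ≤ V.ν x := Iff.rfl

theorem tF_zero : V.tF 0 = 1 := by simp [tF]

theorem tF_add (γ δ : Γ) : V.tF (γ + δ) = V.tF γ * V.tF δ := by simp [tF, ofAdd_add]

theorem tF_ne_zero (γ : Γ) : V.tF γ ≠ 0 := Units.ne_zero _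

theorem tF_neg (γ : Γ) : V.tF (-γ) = (V.tF γ)⁻¹ := by
  apply eq_inv_of_mul_eq_one_left
  rw [← tF_add, neg_add_cancel, tF_zero]

theorem ν_tF (γ : Γ) : V.ν (V.tF γ) = (γ : WithTop Γ) := V.ν_t γ

theorem ν_eq_ord {x : F} (hx : x ≠ 0) : V.ν x = (V.ord x : WithTop Γ) := by
  have h : V.ν x ≠ ⊤ := by rwa [ne_eq, V.ν.top_iff]
  obtain ⟨c, hc⟩ := WithTop.ne_top_iff_exists.1 h
  rw [ord, ← hc, WithTop.untopD_coe]

theorem ord_eq_of_ν_eq {x : F} {c : Γ} (h : V.ν x = (c : WithTop Γ)) : V.ord x = c := by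
  rw [ord, h, WithTop.untopD_coe]

theorem ord_of_ν_eq_zero {x : F} (h : V.ν x = 0) : V.ord x = 0 :=
  V.ord_eq_of_ν_eq (by rw [h]; rfl)

theorem ord_mul {x y : F} (hx : x ≠ 0) (hy : y ≠ 0) : V.ord (x * y) = V.ord x + V.ord y := by
  apply V.ord_eq_of_ν_eq
  rw [V.ν.map_mul, V.ν_eq_ord hx, V.ν_eq_ord hy, WithTop.coe_add]

theorem ν_inv {x : F} (hx : x ≠ 0) : V.ν x⁻¹ = ((-V.ord x : Γ) : WithTop Γ) := by
  have h : V.ν (x * x⁻¹) = 0 := by rw [mul_inv_cancel₀ hx, V.ν.map_one]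
  rw [V.ν.map_mul, V.ν_eq_ord hx, V.ν_eq_ord (inv_ne_zero hx)] at h
  rw [V.ν_eq_ord (inv_ne_zero hx)]
  have h' : V.ord x + V.ord x⁻¹ = 0 := by exact_mod_cast h
  rw [eq_neg_of_add_eq_zero_right h']

theorem res_of_mem {x : F} (h : x ∈ ringOfIntegers V.ν) : V.res x = V.ρ ⟨x, h⟩ := by
  rw [res, dif_pos h]

theorem res_zero : V.res 0 = 0 := by
  rw [V.res_of_mem (zero_mem _)]; exact map_zero V.ρ

theorem res_one : V.res 1 = 1 := by
  rw [V.res_of_mem (one_mem _)]; exact map_one V.ρ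

theorem res_add {x y : F} (hx : x ∈ ringOfIntegers V.ν) (hy : y ∈ ringOfIntegers V.ν) :
    V.res (x + y) = V.res x + V.res y := by
  rw [V.res_of_mem hx, V.res_of_mem hy, V.res_of_mem (add_mem hx hy), ← map_add]; rfl

theorem res_sub {x y : F} (hx : x ∈ ringOfIntegers V.ν) (hy : y ∈ ringOfIntegers V.ν) :
    V.res (x - y) = V.res x - V.res y := by
  rw [V.res_of_mem hx, V.res_of_mem hy, V.res_of_mem (sub_mem hx hy), ← map_sub]; rfl

theorem res_mul {x y : F} (hx : x ∈ ringOfIntegers V.ν) (hy : y ∈ ringOfIntegers V.ν) :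
    V.res (x * y) = V.res x * V.res y := by
  rw [V.res_of_mem hx, V.res_of_mem hy, V.res_of_mem (mul_mem hx hy), ← map_mul]; rfl

theorem ne_zero_of_ν_eq_zero {x : F} (h : V.ν x = 0) : x ≠ 0 := by
  rintro rfl
  rw [V.ν.map_zero] at h
  exact WithTop.top_ne_zero h

theorem ν_inv_of_ν_eq_zero {x : F} (h : V.ν x = 0) : V.ν x⁻¹ = 0 := by
  rw [V.ν_inv (V.ne_zero_of_ν_eq_zero h), V.ord_eq_of_ν_eq (c := 0) (by rw [h]; rfl)]
  simp

theorem res_ne_zero {x : F} (h : V.ν x = 0) : V.res x ≠ 0 := by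
  intro h0
  have h1 : V.res (x * x⁻¹) = 1 := by
    rw [mul_inv_cancel₀ (V.ne_zero_of_ν_eq_zero h), res_one]
  rw [V.res_mul (V.mem_ringOfIntegers_iff.2 h.ge)
    (V.mem_ringOfIntegers_iff.2 (V.ν_inv_of_ν_eq_zero h).ge), h0, zero_mul] at h1
  exact zero_ne_one h1

theorem exists_res_eq (u : k) : ∃ x, x ∈ ringOfIntegers V.ν ∧ V.res x = u := by
  obtain ⟨⟨x, hx⟩, h⟩ := V.ρ_surjective u
  exact ⟨x, hx, by rw [V.res_of_mem hx, h]⟩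

/-- Otherwise some integral $y$ has residue inverse to that of $x$. Then $1-xy$ has valuation 0, so
it is a unit with non-zero residue, although its residue is $1-1=0$. -/
theorem res_eq_zero {x : F} (h : 0 < V.ν x) : V.res x = 0 := by
  by_contra h0
  have hx : x ∈ ringOfIntegers V.ν := V.mem_ringOfIntegers_iff.2 h.le
  obtain ⟨y, hy, hyx⟩ := V.exists_res_eq (V.res x)⁻¹
  have hxy : 0 < V.ν (x * y) := by
    rw [V.ν.map_mul]
    exact add_pos_of_pos_of_nonneg h hy
  have h1 : V.ν (1 - x * y) = 0 := by
    apply le_antisymm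
    · by_contra! hlt
      have := V.ν.map_lt_add hlt hxy
      rw [sub_add_cancel, V.ν.map_one] at this
      exact lt_irrefl _ this
    · exact sub_mem (one_mem _) (mul_mem hx hy)
  apply V.res_ne_zero h1
  rw [V.res_sub (one_mem _) (mul_mem hx hy), V.res_mul hx hy, hyx, res_one, mul_inv_cancel₀ h0,
    sub_self]

/-- The unit `α t(-ν(α))`. -/
def unitPart (α : F) : F := α * V.tF (-V.ord α)

theorem ν_unitPart {α : F} (h : α ≠ 0) : V.ν (V.unitPart α) = 0 := by
  rw [unitPart, V.ν.map_mul, V.ν_eq_ord h, ν_tF, ← WithTop.coe_add, add_neg_cancel]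
  rfl

theorem unitPart_mem {α : F} (h : α ≠ 0) : V.unitPart α ∈ ringOfIntegers V.ν :=
  (V.ν_unitPart h).ge

theorem res_unitPart_ne_zero {α : F} (h : α ≠ 0) : V.res (V.unitPart α) ≠ 0 :=
  V.res_ne_zero (V.ν_unitPart h)

theorem unitPart_mul {α β : F} (hα : α ≠ 0) (hβ : β ≠ 0) :
    V.unitPart (α * β) = V.unitPart α * V.unitPart β := by
  rw [unitPart, V.ord_mul hα hβ, neg_add, tF_add, unitPart, unitPart]; ring

theorem mul_mem_iff {w x : F} (hw : V.ν w = 0) :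
    w * x ∈ ringOfIntegers V.ν ↔ x ∈ ringOfIntegers V.ν := by
  rw [mem_ringOfIntegers_iff, V.ν.map_mul, hw, zero_add, mem_ringOfIntegers_iff]

theorem lift₁_comp_add (g : k → ℂ) (a : F) (γ : Γ) (c x : F) :
    V.lift₁ g a γ (x + c) = V.lift₁ g (a - c) γ x := by
  rw [lift₁, lift₁, show x + c - a = x - (a - c) by ring]

/-- Write $\alpha$ as its unit part times $t(\nu(\alpha))$: the second factor changes the radius of
the ball, while the unit part preserves $\mathcal O$ and acts on residues by multiplication. -/
theorem lift₁_comp_mul (g : k → ℂ) (a : F) (γ : Γ) {α : F} (hα : α ≠ 0) (x : F) :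
    V.lift₁ g a γ (α * x) =
      V.lift₁ (fun u => g (V.res (V.unitPart α) * u)) (α⁻¹ * a) (γ - V.ord α) x := by
  have h : (α * x - a) * V.tF (-γ) =
      V.unitPart α * ((x - α⁻¹ * a) * V.tF (-(γ - V.ord α))) := by
    have h1 := V.tF_ne_zero (V.ord α)
    rw [unitPart, neg_sub, sub_eq_add_neg (V.ord α), V.tF_add, V.tF_neg (V.ord α)]
    field_simp
  rw [lift₁, lift₁, h]
  by_cases hm : (x - α⁻¹ * a) * V.tF (-(γ - V.ord α)) ∈ ringOfIntegers V.ν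
  · rw [if_pos hm, if_pos ((V.mul_mem_iff (V.ν_unitPart hα)).2 hm),
      V.res_mul (V.unitPart_mem hα) hm]
  · rw [if_neg hm, if_neg (mt (V.mul_mem_iff (V.ν_unitPart hα)).1 hm)]

end Algebra

section AbsF

variable {F Γ k : Type*} [Field F] [AddCommGroup Γ] [LinearOrder Γ] [IsOrderedAddMonoid Γ]
  [NontriviallyNormedField k] [LocallyCompactSpace k] (V : SplitValuedField F Γ k)

theorem absF_def (α : F) :
    V.absF α = constC Γ (modulus (V.res (V.unitPart α)) : ℂ) * Xpow (V.ord α) := rfl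

theorem absF_mul {α β : F} (hα : α ≠ 0) (hβ : β ≠ 0) :
    V.absF (α * β) = V.absF α * V.absF β := by
  rw [absF_def, absF_def, absF_def, V.unitPart_mul hα hβ,
    V.res_mul (V.unitPart_mem hα) (V.unitPart_mem hβ), modulus_mul, V.ord_mul hα hβ, Xpow_add,
    Complex.ofReal_mul, constC_mul]
  ring

theorem absF_one : V.absF 1 = 1 := by
  rw [absF_def, unitPart, V.ord_of_ν_eq_zero V.ν.map_one, neg_zero, tF_zero, mul_one, res_one,
    modulus_one, Xpow_zero, Complex.ofReal_one, constC_one, mul_one]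

theorem absF_neg_one : V.absF (-1) = 1 := by
  have h : V.ν (-1) = 0 := by rw [V.ν.map_neg, V.ν.map_one]
  have h2 : V.res (-1) = -1 := by
    rw [← zero_sub, V.res_sub (zero_mem _) (one_mem _), res_zero, res_one, zero_sub]
  rw [absF_def, unitPart, V.ord_of_ν_eq_zero h, neg_zero, tF_zero, mul_one, h2,
    modulus_neg_one, Xpow_zero, Complex.ofReal_one, constC_one, mul_one]

theorem absF_neg_one_pow (m : ℕ) : V.absF ((-1) ^ m) = 1 := by
  rcases neg_one_pow_eq_or F m with h | h <;> rw [h]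
  · exact V.absF_one
  · exact V.absF_neg_one

theorem absF_inv_eq {α : F} :
    (V.absF α)⁻¹ =
      constC Γ ((modulus (V.res (V.unitPart α)) : ℝ) : ℂ)⁻¹ * Xpow (-V.ord α) := by
  rw [absF_def, mul_inv, constC_inv, Xpow_neg]

end AbsF

end SplitValuedField

attribute [local instance] secondCountableTopology_of_locallyCompactSpace

/-! ### Sampling lifts along the residue classes of a ball. -/

namespace SplitValuedField

variable {F Γ k : Type*} [Field F] [AddCommGroup Γ] [LinearOrder Γ] [IsOrderedAddMonoid Γ]

section Residue

variable [Field k] (V : SplitValuedField F Γ k)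

/-- A section of the residue map. -/
def resSection (u : k) : F := (V.exists_res_eq u).choose

theorem resSection_mem (u : k) : V.resSection u ∈ ringOfIntegers V.ν :=
  (V.exists_res_eq u).choose_spec.1

theorem res_resSection (u : k) : V.res (V.resSection u) = u :=
  (V.exists_res_eq u).choose_spec.2

/-- A point of the ball `a + t(γ)𝒪` with residue coordinate `u`. -/
def ballPoint (a : F) (γ : Γ) (u : k) : F := a + V.tF γ * V.resSection u

theorem ballPoint_sub_mul (a b : F) (γ δ : Γ) (u : k) :
    (V.ballPoint a γ u - b) * V.tF (-δ) =
      (a - b) * V.tF (-δ) + V.tF (γ - δ) * V.resSection u := by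
  rw [ballPoint, sub_eq_add_neg γ, V.tF_add]; ring

theorem lift₁_ballPoint_of_eq (g : k → ℂ) {a b : F} {γ : Γ}
    (h : (a - b) * V.tF (-γ) ∈ ringOfIntegers V.ν) (u : k) :
    V.lift₁ g b γ (V.ballPoint a γ u) = g (V.res ((a - b) * V.tF (-γ)) + u) := by
  rw [lift₁, V.ballPoint_sub_mul, sub_self, tF_zero, one_mul,
    if_pos (add_mem h (V.resSection_mem u)), V.res_add h (V.resSection_mem u), res_resSection]

theorem lift₁_ballPoint_of_notMem (g : k → ℂ) {a b : F} {γ : Γ}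
    (h : (a - b) * V.tF (-γ) ∉ ringOfIntegers V.ν) (u : k) :
    V.lift₁ g b γ (V.ballPoint a γ u) = 0 := by
  rw [lift₁, V.ballPoint_sub_mul, sub_self, tF_zero, one_mul, if_neg]
  intro h'
  apply h
  simpa using sub_mem h' (V.resSection_mem u)

theorem ν_tF_mul_pos {γ : Γ} (h : 0 < γ) {x : F} (hx : x ∈ ringOfIntegers V.ν) :
    0 < V.ν (V.tF γ * x) := by
  rw [V.ν.map_mul, ν_tF]
  exact add_pos_of_pos_of_nonneg (by exact_mod_cast h) hx

/-- Two points of the smaller ball have the same residue coordinate in the larger scale. -/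
theorem lift₁_ballPoint_of_lt (g : k → ℂ) {a b : F} {γ δ : Γ} (h : δ < γ) (u : k) :
    V.lift₁ g b δ (V.ballPoint a γ u) = V.lift₁ g b δ a := by
  have hp := V.ν_tF_mul_pos (sub_pos.2 h) (V.resSection_mem u)
  have hm : V.tF (γ - δ) * V.resSection u ∈ ringOfIntegers V.ν := hp.le
  rw [lift₁, V.ballPoint_sub_mul, lift₁]
  by_cases hab : (a - b) * V.tF (-δ) ∈ ringOfIntegers V.ν
  · rw [if_pos hab, if_pos (add_mem hab hm), V.res_add hab hm, V.res_eq_zero hp, add_zero]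
  · rw [if_neg hab, if_neg]
    intro h'
    apply hab
    simpa using sub_mem h' hm

/-- Two sample points in one ball of the finer scale differ, in the coarser scale, by an element of
positive valuation, so their residues agree. -/
theorem eq_of_lift₁_ballPoint_ne_zero (g : k → ℂ) {a b : F} {γ δ : Γ} (h : γ < δ) {u u' : k}
    (hu : V.lift₁ g b δ (V.ballPoint a γ u) ≠ 0) (hu' : V.lift₁ g b δ (V.ballPoint a γ u') ≠ 0) :
    u = u' := by
  have key : ∀ v, V.lift₁ g b δ (V.ballPoint a γ v) ≠ 0 →
      (V.ballPoint a γ v - b) * V.tF (-δ) ∈ ringOfIntegers V.ν := by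
    intro v hv
    by_contra hn
    exact hv (by rw [lift₁, if_neg hn])
  have hs := sub_mem (key u hu) (key u' hu')
  have hp := V.ν_tF_mul_pos (sub_pos.2 h) hs
  have e : V.tF (δ - γ) * ((V.ballPoint a γ u - b) * V.tF (-δ) -
      (V.ballPoint a γ u' - b) * V.tF (-δ)) = V.resSection u - V.resSection u' := by
    have h1 := V.tF_ne_zero δ
    have h2 := V.tF_ne_zero γ
    rw [ballPoint, ballPoint, sub_eq_add_neg δ, V.tF_add, V.tF_neg, V.tF_neg]
    field_simp
    ring
  rw [e] at hp
  have := V.res_eq_zero hp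
  rw [V.res_sub (V.resSection_mem u) (V.resSection_mem u'), res_resSection, res_resSection] at this
  exact sub_eq_zero.1 this

end Residue

/-! ### Existence of the integral on $F$. -/

variable [NontriviallyNormedField k] [MeasurableSpace k]
  (V : SplitValuedField F Γ k) (μ : Measure k)

open Classical in
theorem exists_integrable_lift₁_ballPoint_sub_const [LocallyCompactSpace k] [BorelSpace k]
    [μ.IsAddHaarMeasure]
    {g : k → ℂ} (hg : Integrable g μ) (a b : F) (γ δ : Γ) :
    ∃ c : ℂ, Integrable (fun u => V.lift₁ g b δ (V.ballPoint a γ u) - c) μ ∧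
      ∫ u, (V.lift₁ g b δ (V.ballPoint a γ u) - c) ∂μ =
        if δ = γ ∧ (a - b) * V.tF (-γ) ∈ ringOfIntegers V.ν then ∫ u, g u ∂μ else 0 := by
  rcases lt_trichotomy δ γ with h | rfl | h
  -- The lift has the coarser scale: it is constant along the samples, and subtracting that constant
  -- leaves zero.
  · refine ⟨V.lift₁ g b δ a, ?_⟩
    rw [if_neg (fun h' => h.ne h'.1)]
    simp [V.lift₁_ballPoint_of_lt g h]
  · refine ⟨0, ?_⟩
    by_cases hab : (a - b) * V.tF (-δ) ∈ ringOfIntegers V.ν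
    · rw [if_pos ⟨rfl, hab⟩]
      simp only [V.lift₁_ballPoint_of_eq g hab, sub_zero]
      exact ⟨hg.comp_add_left _, integral_add_left_eq_self g _⟩
    · rw [if_neg (fun h' => hab h'.2)]
      simp [V.lift₁_ballPoint_of_notMem g hab]
  · refine ⟨0, ?_⟩
    rw [if_neg (fun h' => h.ne' h'.1)]
    simp only [sub_zero]
    have hs : (Function.support fun u => V.lift₁ g b δ (V.ballPoint a γ u)).Subsingleton :=
      fun u hu u' hu' => V.eq_of_lift₁_ballPoint_ne_zero g h hu hu'
    -- The lift has the finer scale: at most one sample is non-zero, and Haar measure here has no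
    -- atoms.
    have h0 : (fun u => V.lift₁ g b δ (V.ballPoint a γ u)) =ᵐ[μ] 0 := by
      have := hs.measure_zero μ
      rwa [Filter.EventuallyEq, ae_iff]
    exact ⟨(integrable_congr h0).2 (integrable_zero _ _ _), by rw [integral_congr_ae h0]; simp⟩

/-- The data `(g, a, γ)` of a lift of an integrable function. -/
abbrev LiftData (F Γ : Type*) {k : Type*} [NontriviallyNormedField k] [MeasurableSpace k]
    (μ : Measure k) : Type _ :=
  {g : k → ℂ // Integrable g μ} × F × Γ

/-- Two lifts live on the same ball. -/
def ballSetoid : Setoid (LiftData F Γ μ) where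
  r i j := j.2.2 = i.2.2 ∧ (i.2.1 - j.2.1) * V.tF (-i.2.2) ∈ ringOfIntegers V.ν
  iseqv :=
    { refl := fun i => ⟨rfl, by simp [zero_mem]⟩
      symm := by
        rintro i j ⟨h, h'⟩
        refine ⟨h.symm, ?_⟩
        rw [h]
        simpa [← neg_mul] using neg_mem h'
      trans := by
        rintro i j l ⟨h, h'⟩ ⟨h2, h2'⟩
        refine ⟨h2.trans h, ?_⟩
        rw [h] at h2'
        simpa [← add_mul] using add_mem h' h2' }

open Classical in
-- Sampling on the ball of $i$ and integrating isolates the terms living on that ball, once the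
-- constants coming from larger balls are known to cancel.
theorem sum_integral_eq_zero_of_sum_lift₁_eq_zero [LocallyCompactSpace k] [BorelSpace k]
    [μ.IsAddHaarMeasure]
    (s : Finset (LiftData F Γ μ)) (z : LiftData F Γ μ → ℂ)
    (h : ∀ x, ∑ j ∈ s, z j * V.lift₁ j.1.1 j.2.1 j.2.2 x = 0) (i : LiftData F Γ μ) :
    ∑ j ∈ s with (V.ballSetoid μ) i j, z j * ∫ u, j.1.1 u ∂μ = 0 := by
  choose c hc hc' using fun j : LiftData F Γ μ =>
    V.exists_integrable_lift₁_ballPoint_sub_const μ j.1.2 i.2.1 j.2.1 i.2.2 j.2.2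
  have e : ∀ u, ∑ j ∈ s, z j * (V.lift₁ j.1.1 j.2.1 j.2.2 (V.ballPoint i.2.1 i.2.2 u) - c j) =
      -∑ j ∈ s, z j * c j := by
    intro u
    simp only [mul_sub, Finset.sum_sub_distrib, h, zero_sub]
  have hint : Integrable (fun _ : k => -∑ j ∈ s, z j * c j) μ := by
    rw [show (fun _ : k => -∑ j ∈ s, z j * c j) = _ from funext fun u => (e u).symm]
    exact integrable_finsetSum _ fun j _ => (hc j).const_mul _
  -- A constant integrable over a space of infinite measure vanishes.
  have h0 : -∑ j ∈ s, z j * c j = 0 := by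
    rcases integrable_const_iff.1 hint with h0 | h0
    · exact h0
    · exact absurd (isFiniteMeasure_iff μ |>.1 h0) (by simp)
  have h1 : ∑ j ∈ s, z j *
      ∫ u, (V.lift₁ j.1.1 j.2.1 j.2.2 (V.ballPoint i.2.1 i.2.2 u) - c j) ∂μ = 0 := by
    simp only [← integral_const_mul]
    rw [← integral_finsetSum _ fun j _ => (hc j).const_mul _]
    simp only [e, h0, integral_zero]
  simp only [hc'] at h1
  rw [← h1, Finset.sum_filter]
  refine Finset.sum_congr rfl fun j _ => ?_
  rw [mul_ite, mul_zero]
  exact if_congr Iff.rfl rfl rfl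

/-- The function given by a formal combination of lifts. -/
def combination : (LiftData F Γ μ →₀ CGamma Γ) →ₗ[CGamma Γ] (F → CGamma Γ) :=
  Finsupp.linearCombination _ fun j x => constC Γ (V.lift₁ j.1.1 j.2.1 j.2.2 x)

/-- The integral of a formal combination of lifts. -/
def combinationIntegral : (LiftData F Γ μ →₀ CGamma Γ) →ₗ[CGamma Γ] CGamma Γ :=
  Finsupp.linearCombination _ fun j => constC Γ (∫ u, j.1.1 u ∂μ) * Xpow j.2.2

theorem combination_apply (p : LiftData F Γ μ →₀ CGamma Γ) (x : F) :
    V.combination μ p x =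
      Finsupp.linearCombination _ (fun j => constC Γ (V.lift₁ j.1.1 j.2.1 j.2.2 x)) p := by
  rw [combination, Finsupp.linearCombination_apply, Finsupp.linearCombination_apply, Finsupp.sum,
    Finset.sum_apply]
  rfl

open Classical in
theorem combinationIntegral_eq_zero [LocallyCompactSpace k] [BorelSpace k]
    [μ.IsAddHaarMeasure]
    {p : LiftData F Γ μ →₀ CGamma Γ} (hp : V.combination μ p = 0) :
    combinationIntegral μ p = 0 := by
  rw [combinationIntegral, Finsupp.linearCombination_apply, Finsupp.sum]
  -- The cancellation takes place ball by ball; lifts on one ball share the radius, so the power of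
  -- $X$ factors out.
  refine Finset.sum_cancels_of_partition_cancels (V.ballSetoid μ) fun i _ => ?_
  suffices hs : ∑ j ∈ p.support with (V.ballSetoid μ) i j, p j * constC Γ (∫ u, j.1.1 u ∂μ) = 0 by
    rw [← zero_mul (Xpow i.2.2), ← hs, Finset.sum_mul]
    refine Finset.sum_congr ?_ fun j hj => ?_
    · ext j
      simp only [Finset.mem_filter]
      exact and_congr_right fun _ => ⟨(V.ballSetoid μ).symm', (V.ballSetoid μ).symm'⟩
    · rw [smul_eq_mul, ← mul_assoc, ((V.ballSetoid μ).symm' (Finset.mem_filter.1 hj).2).1]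
  rw [← Module.forall_dual_apply_eq_zero_iff ℂ]
  intro l
  simp only [map_sum, dual_mul_constC]
  refine V.sum_integral_eq_zero_of_sum_lift₁_eq_zero μ p.support (fun j => l (p j)) (fun x => ?_) i
  have := congrArg l (congrFun hp x)
  simpa only [V.combination_apply, Finsupp.linearCombination_apply, Finsupp.sum, smul_eq_mul,
    map_sum, dual_mul_constC, Pi.zero_apply, map_zero] using this

theorem integrableSpace_eq_range :
    V.integrableSpace μ = LinearMap.range (V.combination μ) := by
  rw [combination, Finsupp.range_linearCombination, integrableSpace]
  apply le_antisymm <;> rw [Submodule.span_le]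
  · rintro _ ⟨g, hg, a, γ, δ, rfl⟩
    have : (fun x => constC Γ (V.lift₁ g a γ x) * Xpow δ) =
        Xpow δ • fun x => constC Γ (V.lift₁ g a γ x) := by
      funext x
      exact mul_comm _ _
    rw [this]
    exact Submodule.smul_mem _ _ (Submodule.subset_span ⟨(⟨g, hg⟩, a, γ), rfl⟩)
  · rintro _ ⟨⟨⟨g, hg⟩, a, γ⟩, rfl⟩
    exact Submodule.subset_span ⟨g, hg, a, γ, 0, by simp [Xpow_zero]⟩

theorem exists_isIntegralFunctional [LocallyCompactSpace k] [BorelSpace k]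
    [μ.IsAddHaarMeasure] :
    ∃ I, V.IsIntegralFunctional μ I := by
  have hker : LinearMap.ker (V.combination μ) ≤ LinearMap.ker (combinationIntegral μ) :=
    fun p hp => V.combinationIntegral_eq_zero μ hp
  -- The formal integral descends to the quotient by the relations, so any representation of a
  -- function computes its integral. The invariance properties then follow by relabelling the data
  -- of a representation.
  obtain ⟨I, hI⟩ : ∃ I : V.integrableSpace μ →ₗ[CGamma Γ] CGamma Γ,
      ∀ (f : V.integrableSpace μ) p, V.combination μ p = f.1 →
        I f = combinationIntegral μ p := by
    refine ⟨((LinearMap.ker (V.combination μ)).liftQ (combinationIntegral μ) hker) ∘ₗ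
      (V.combination μ).quotKerEquivRange.symm.toLinearMap ∘ₗ
      (LinearEquiv.ofEq _ _ (V.integrableSpace_eq_range μ)).toLinearMap, ?_⟩
    rintro ⟨f, hf⟩ p rfl
    have : (V.combination μ).quotKerEquivRange.symm
        (LinearEquiv.ofEq _ _ (V.integrableSpace_eq_range μ) ⟨V.combination μ p, hf⟩) =
        Submodule.Quotient.mk p :=
      LinearMap.quotKerEquivRange_symm_apply_image _ p ⟨p, rfl⟩
    simp only [LinearMap.comp_apply, LinearEquiv.coe_coe, this]
    exact Submodule.liftQ_apply _ _ _
  have hrep : ∀ f : V.integrableSpace μ, ∃ p, V.combination μ p = f.1 := by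
    intro f
    exact LinearMap.mem_range.1 (V.integrableSpace_eq_range μ ▸ f.2)
  refine ⟨I, ?_, ?_, ?_⟩
  · intro g hg f hf
    rw [hI f (Finsupp.single (⟨g, hg⟩, 0, 0) 1)]
    · simp [combinationIntegral, Xpow_zero]
    · funext x
      simp [combination, hf x]
  · intro f f' a hf
    obtain ⟨p, hp⟩ := hrep f
    rw [hI f p hp, hI f' (p.mapDomain fun j => (j.1, j.2.1 - a, j.2.2)),
      combinationIntegral, Finsupp.linearCombination_mapDomain]
    · rfl
    · funext x
      rw [hf x, ← hp, V.combination_apply, V.combination_apply,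
        Finsupp.linearCombination_mapDomain]
      congr 2
      funext j
      simp [V.lift₁_comp_add]
  · intro f f' α hα hf
    obtain ⟨p, hp⟩ := hrep f
    have hα' := V.res_unitPart_ne_zero hα
    rw [hI f p hp, hI f' (p.mapDomain fun j =>
      (⟨_, integrable_comp_mul_left μ j.1.2 hα'⟩, α⁻¹ * j.2.1, j.2.2 - V.ord α)),
      combinationIntegral, Finsupp.linearCombination_mapDomain,
      Finsupp.linearCombination_apply, Finsupp.linearCombination_apply, Finsupp.mul_sum]
    · refine Finsupp.sum_congr fun j _ => ?_
      simp only [Function.comp_apply, integral_comp_mul_left μ hα', smul_eq_mul, constC_mul,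
        sub_eq_add_neg, Xpow_add, V.absF_inv_eq]
      ring
    · funext x
      rw [hf x, ← hp, V.combination_apply, V.combination_apply,
        Finsupp.linearCombination_mapDomain]
      congr 2
      funext j
      simp [V.lift₁_comp_mul _ _ _ hα]

/-- Existence suffices to unfold the choice; later computations use only the three characteristic
properties, never uniqueness. -/
theorem isIntegralFunctional_integralFunctional [LocallyCompactSpace k] [BorelSpace k]
    [μ.IsAddHaarMeasure] :
    V.IsIntegralFunctional μ (V.integralFunctional μ) :=
  Classical.epsilon_spec (V.exists_isIntegralFunctional μ)

/-! ### Affine substitutions in one variable. -/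

theorem isSimple_lift₁_comp_affine [LocallyCompactSpace k] [BorelSpace k]
    [μ.IsAddHaarMeasure] {g : k → ℂ}
    (hg : Integrable g μ) {α : F} (hα : α ≠ 0) (c : F) (δ : Γ) :
    V.IsSimple μ fun x => constC Γ (V.lift₁ g 0 0 (α * x + c)) * Xpow δ := by
  simp only [V.lift₁_comp_add, V.lift₁_comp_mul _ _ _ hα]
  exact ⟨_, integrable_comp_mul_left μ hg (V.res_unitPart_ne_zero hα), _, _, _, rfl⟩

theorem integral_lift₁_comp_affine [LocallyCompactSpace k] [BorelSpace k]
    [μ.IsAddHaarMeasure] {g : k → ℂ}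
    (hg : Integrable g μ) {α : F} (hα : α ≠ 0) (c : F) (δ : Γ) :
    V.integral μ (fun x => constC Γ (V.lift₁ g 0 0 (α * x + c)) * Xpow δ) =
      (V.absF α)⁻¹ * (constC Γ (∫ u, g u ∂μ) * Xpow δ) := by
  obtain ⟨h1, h2, h3⟩ := V.isIntegralFunctional_integralFunctional μ
  have hmem : ∀ (β d : F) (ε : Γ), β ≠ 0 →
      (fun x => constC Γ (V.lift₁ g 0 0 (β * x + d)) * Xpow ε) ∈ V.integrableSpace μ :=
    fun β d ε hβ => Submodule.subset_span (V.isSimple_lift₁_comp_affine μ hg hβ d ε)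
  rw [integral, dif_pos (hmem α c δ hα), h3 ⟨_, hmem 1 c δ one_ne_zero⟩ _ α hα (by simp),
    h2 ⟨_, hmem 1 0 δ one_ne_zero⟩ ⟨_, hmem 1 c δ one_ne_zero⟩ c (by simp)]
  have e : (⟨_, hmem 1 0 δ one_ne_zero⟩ : V.integrableSpace μ) =
      Xpow δ • ⟨_, hmem 1 0 0 one_ne_zero⟩ := by
    ext x
    simp [Xpow_zero, mul_comm]
  rw [e, map_smul, h1 g hg _ (by simp [Xpow_zero]), smul_eq_mul, mul_comm (Xpow δ)]

theorem isSimple_zero : V.IsSimple μ fun _ => 0 :=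
  ⟨0, integrable_zero k ℂ μ, 0, 0, 0, by simp [lift₁, constC_zero]⟩

theorem integral_zero [LocallyCompactSpace k] : V.integral μ (fun _ => 0) = 0 := by
  have h : (fun _ : F => (0 : CGamma Γ)) ∈ V.integrableSpace μ := zero_mem _
  rw [integral, dif_pos h]
  exact map_zero _

end SplitValuedField

/-! ### Shears, block matrices and elimination. -/

section Matrices

variable {R : Type*} [CommRing R]

theorem exists_generalLinear_shear {n : ℕ} (i : Fin n) {c : Fin n → R} (hc : c i = 0) :
    ∃ σ : GL (Fin n) R, ∀ u,
      (σ : Matrix (Fin n) (Fin n) R).mulVec u = fun j => u j + u i * c j := by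
  -- The shear is $1+N$ with $N^2=0$, because $c_i=0$; hence its inverse is $1-N$.
  have hN : Matrix.vecMulVec c (Pi.single i 1) * Matrix.vecMulVec c (Pi.single i 1) = 0 := by
    rw [Matrix.vecMulVec_mul_vecMulVec]
    simp [hc]
  refine ⟨⟨1 + Matrix.vecMulVec c (Pi.single i 1), 1 - Matrix.vecMulVec c (Pi.single i 1), ?_, ?_⟩,
    fun u => ?_⟩
  · simp [add_mul, mul_sub, hN]
  · simp [sub_mul, mul_add, hN]
  · funext j
    simp [Matrix.add_mulVec, Matrix.vecMulVec_mulVec, mul_comm]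

/-- The block diagonal matrix with a block `1` in row and column `i`. -/
def insertOne {n : ℕ} (i : Fin (n + 1)) (A : Matrix (Fin n) (Fin n) R) :
    Matrix (Fin (n + 1)) (Fin (n + 1)) R :=
  Matrix.of (i.insertNth (i.insertNth 1 0 : Fin (n + 1) → R) fun p => i.insertNth 0 (A p))

theorem insertOne_mulVec {n : ℕ} (i : Fin (n + 1)) (A : Matrix (Fin n) (Fin n) R) (u : R)
    (y : Fin n → R) :
    (insertOne i A).mulVec (i.insertNth u y) = i.insertNth u (A.mulVec y) := by
  funext p
  cases p using Fin.succAboveCases i <;>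
    simp [insertOne, Matrix.mulVec, dotProduct, Fin.sum_univ_succAbove _ i]

theorem insertOne_mul {n : ℕ} (i : Fin (n + 1)) (A B : Matrix (Fin n) (Fin n) R) :
    insertOne i A * insertOne i B = insertOne i (A * B) := by
  ext p q
  cases p using Fin.succAboveCases i <;> cases q using Fin.succAboveCases i <;>
    simp [insertOne, Matrix.mul_apply, Fin.sum_univ_succAbove _ i]

theorem insertOne_one {n : ℕ} (i : Fin (n + 1)) :
    insertOne i (1 : Matrix (Fin n) (Fin n) R) = 1 := by
  ext p q
  cases p using Fin.succAboveCases i <;> cases q using Fin.succAboveCases i <;>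
    simp [insertOne, Matrix.one_apply]

/-- The block diagonal element of `GLₙ₊₁` with a block `1` in row and column `i`. -/
def generalLinearInsertOne {n : ℕ} (i : Fin (n + 1)) (σ : GL (Fin n) R) : GL (Fin (n + 1)) R where
  val := insertOne i σ
  inv := insertOne i (σ⁻¹ : GL (Fin n) R)
  val_inv := by rw [insertOne_mul, ← Units.val_mul, mul_inv_cancel, Units.val_one, insertOne_one]
  inv_val := by rw [insertOne_mul, ← Units.val_mul, inv_mul_cancel, Units.val_one, insertOne_one]

theorem mulVec_insertNth_sub {n : ℕ} {A : Matrix (Fin (n + 1)) (Fin (n + 1)) R} {i r : Fin (n + 1)}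
    (hA : ∀ p, A (i.succAbove p) r = 0) (b : Fin (n + 1) → R) (x : R) (y : Fin n → R) :
    A.mulVec (r.insertNth x y) - b =
      i.insertNth (A i r * x + (∑ j, A i (r.succAbove j) * y j - b i))
        ((A.submatrix i.succAbove r.succAbove).mulVec y - fun p => b (i.succAbove p)) := by
  funext p
  cases p using Fin.succAboveCases i <;>
    simp [Matrix.mulVec, dotProduct, Fin.sum_univ_succAbove _ r, hA, add_sub_assoc]

theorem det_eq_of_column {n : ℕ} {A : Matrix (Fin (n + 1)) (Fin (n + 1)) R} {i r : Fin (n + 1)}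
    (hA : ∀ p, A (i.succAbove p) r = 0) :
    A.det = (-1) ^ (i + r : ℕ) * A i r * (A.submatrix i.succAbove r.succAbove).det := by
  rw [Matrix.det_succ_column A r, Fin.sum_univ_succAbove _ i]
  simp [hA]

theorem det_sub_mul_row {n : ℕ} (A : Matrix (Fin n) (Fin n) R) {i : Fin n} {c : Fin n → R}
    (hc : c i = 0) : (Matrix.of fun p q => A p q - c p * A i q).det = A.det := by
  refine (Matrix.det_eq_of_forall_row_eq_smul_add_const c i hc fun p q => ?_).symm
  simp [hc]

end Matrices

/-! ### GL-Fubini functions over the residue field. -/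

section ResFubini

variable {k : Type*} [MeasurableSpace k] {μ : Measure k}

theorem ResFubini.integrable {n : ℕ} {g : (Fin n → k) → ℂ} (h : ResFubini μ n g) :
    Integrable g (Measure.pi fun _ => μ) := by
  cases n with
  | zero =>
    rw [show g = fun _ => g Fin.elim0 from funext fun x => congrArg g (Subsingleton.elim _ _),
      Measure.pi_of_empty]
    exact integrable_const _
  | succ n => exact h.1

theorem ResFubini.const_mul {n : ℕ} {g : (Fin n → k) → ℂ} (h : ResFubini μ n g) (c : ℂ) :
    ResFubini μ n fun u => c * g u := by
  induction n with
  | zero => trivial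
  | succ n ih =>
    refine ⟨h.1.const_mul c, fun r => ⟨fun y => ((h.2 r).1 y).const_mul c, ?_⟩⟩
    simp only [integral_const_mul]
    exact ih (h.2 r).2

theorem GLFubini.resFubini [Field k] {n : ℕ} {g : (Fin n → k) → ℂ} (h : GLFubini μ n g) :
    ResFubini μ n g := by
  simpa using h 1

theorem GLFubini.const_mul [Field k] {n : ℕ} {g : (Fin n → k) → ℂ} (h : GLFubini μ n g)
    (c : ℂ) :
    GLFubini μ n fun u => c * g u :=
  fun σ => (h σ).const_mul c

theorem GLFubini.comp_mulVec [Field k] {n : ℕ} {g : (Fin n → k) → ℂ} (h : GLFubini μ n g)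
    (σ : GL (Fin n) k) :
    GLFubini μ n fun u => g ((σ : Matrix (Fin n) (Fin n) k).mulVec u) := by
  intro σ'
  simpa using h (σ * σ')

/-- A substitution in the remaining variables extends to all variables as a block matrix fixing the
integrated one, so it commutes with the partial integral. -/
theorem GLFubini.integral_insertNth [Field k] {n : ℕ} {g : (Fin (n + 1) → k) → ℂ}
    (h : GLFubini μ (n + 1) g) (i : Fin (n + 1)) :
    GLFubini μ n fun y => ∫ u, g (i.insertNth u y) ∂μ := by
  intro σ
  have := ((h (generalLinearInsertOne i σ)).2 i).2
  simpa only [generalLinearInsertOne, insertOne_mulVec] using this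

theorem integral_integral_insertNth [SigmaFinite μ] {n : ℕ} {g : (Fin (n + 1) → k) → ℂ}
    (hg : Integrable g (Measure.pi fun _ => μ)) (i : Fin (n + 1)) :
    ∫ y, ∫ u, g (i.insertNth u y) ∂μ ∂(Measure.pi fun _ => μ) =
        ∫ u, g u ∂(Measure.pi fun _ => μ) ∧
      ∫ u, ∫ y, g (i.insertNth u y) ∂(Measure.pi fun _ => μ) ∂μ =
        ∫ u, g u ∂(Measure.pi fun _ => μ) := by
  have hmp := (measurePreserving_piFinSuccAbove (fun _ : Fin (n + 1) => μ) i).symm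
  have hint := (hmp.integrable_comp_emb (MeasurableEquiv.measurableEmbedding _)).2 hg
  rw [← hmp.integral_comp' g]
  exact ⟨(integral_prod_symm _ hint).symm, (integral_prod _ hint).symm⟩

/-- With $u_i$ held fixed the shear translates the other variables, so the inner integral is
unchanged; Fubini applies on both sides. -/
theorem integral_comp_shear [NontriviallyNormedField k] [LocallyCompactSpace k] [BorelSpace k]
    [μ.IsAddHaarMeasure] {n : ℕ} {g : (Fin (n + 1) → k) → ℂ} (i : Fin (n + 1))
    {c : Fin (n + 1) → k} (hc : c i = 0)
    (hg : Integrable g (Measure.pi fun _ => μ))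
    (hg' : Integrable (fun u => g fun j => u j + u i * c j) (Measure.pi fun _ => μ)) :
    ∫ u, g (fun j => u j + u i * c j) ∂(Measure.pi fun _ => μ) =
      ∫ u, g u ∂(Measure.pi fun _ => μ) := by
  rw [← (integral_integral_insertNth hg' i).2, ← (integral_integral_insertNth hg i).2]
  congr 1
  funext u
  have e : ∀ y : Fin n → k, (fun j => (i.insertNth u y : Fin (n + 1) → k) j +
      (i.insertNth u y : Fin (n + 1) → k) i * c j) =
      i.insertNth u (y + fun p => u * c (i.succAbove p)) := by
    intro y
    funext j
    cases j using Fin.succAboveCases i <;> simp [hc]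
  simp only [e]
  exact integral_add_right_eq_self (μ := Measure.pi fun _ : Fin n => μ)
    (fun y => g (i.insertNth u y)) _

end ResFubini

/-! ### Lifts in several variables and integral row operations. -/

namespace SplitValuedField

variable {F Γ k : Type*} [Field F] [AddCommGroup Γ] [LinearOrder Γ] [IsOrderedAddMonoid Γ]

section Lift

variable [Field k] (V : SplitValuedField F Γ k)

open Classical in
theorem lift_zero_zero {n : ℕ} (g : (Fin n → k) → ℂ) (z : Fin n → F) :
    V.lift g 0 0 z =
      if ∀ i, z i ∈ ringOfIntegers V.ν then g (fun i => V.res (z i)) else 0 := by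
  simp [lift, tF_zero]

open Classical in
theorem lift₁_zero_zero (g : k → ℂ) (x : F) :
    V.lift₁ g 0 0 x = if x ∈ ringOfIntegers V.ν then g (V.res x) else 0 := by
  simp [lift₁, tF_zero]

theorem lift_eq_lift_zero_zero {n : ℕ} (g : (Fin n → k) → ℂ) (a : Fin n → F) (γ : Fin n → Γ)
    (x : Fin n → F) :
    V.lift g a γ x = V.lift g 0 0 fun i => (x i - a i) * V.tF (-γ i) := by
  rw [lift_zero_zero, lift]

open Classical in
theorem lift_insertNth {n : ℕ} (g : (Fin (n + 1) → k) → ℂ) (i : Fin (n + 1)) (w : F)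
    (z : Fin n → F) :
    V.lift g 0 0 (i.insertNth w z) =
      if ∀ p, z p ∈ ringOfIntegers V.ν then
        V.lift₁ (fun u => g (i.insertNth u fun p => V.res (z p))) 0 0 w
      else 0 := by
  have e : (fun j => V.res ((i.insertNth w z : Fin (n + 1) → F) j)) =
      i.insertNth (V.res w) fun p => V.res (z p) := by
    funext j
    cases j using Fin.succAboveCases i <;> simp
  have e' : (∀ j, (i.insertNth w z : Fin (n + 1) → F) j ∈ ringOfIntegers V.ν) ↔
      w ∈ ringOfIntegers V.ν ∧ ∀ p, z p ∈ ringOfIntegers V.ν := by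
    simp [Fin.forall_iff_succAbove i]
  rw [lift_zero_zero, lift₁_zero_zero, e]
  simp only [e']
  by_cases h1 : w ∈ ringOfIntegers V.ν <;>
    by_cases h2 : ∀ p, z p ∈ ringOfIntegers V.ν <;> simp [h1, h2]

/-- The substitution $z\mapsto z-z_ic$ preserves $\mathcal O^n$ in both directions since $c$ is
integral and $z_i$ is fixed; the shear on residues undoes it. -/
theorem lift_eq_lift_comp_shear {n : ℕ} (g : (Fin n → k) → ℂ) {i : Fin n} {c : Fin n → F}
    (hc : c i = 0) (hc' : ∀ p, c p ∈ ringOfIntegers V.ν) (z : Fin n → F) :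
    V.lift g 0 0 z =
      V.lift (fun u => g fun j => u j + u i * V.res (c j)) 0 0 fun p => z p - z i * c p := by
  rw [lift_zero_zero, lift_zero_zero]
  have e : (∀ p, z p ∈ ringOfIntegers V.ν) ↔ ∀ p, z p - z i * c p ∈ ringOfIntegers V.ν := by
    constructor
    · exact fun h p => sub_mem (h p) (mul_mem (h i) (hc' p))
    · intro h p
      have hi := h i
      rw [hc, mul_zero, sub_zero] at hi
      simpa using add_mem (h p) (mul_mem hi (hc' p))
  by_cases h : ∀ p, z p ∈ ringOfIntegers V.ν
  · rw [if_pos h, if_pos (e.1 h)]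
    congr 1
    funext p
    dsimp only
    rw [V.res_sub (h p) (mul_mem (h i) (hc' p)), V.res_mul (h i) (hc' p), hc, mul_zero, sub_zero,
      sub_add_cancel]
  · rw [if_neg h, if_neg (mt e.2 h)]

/-- An entry of least valuation serves as pivot. -/
theorem exists_forall_div_mem {n : ℕ} {v : Fin n → F} (hv : v ≠ 0) :
    ∃ i, v i ≠ 0 ∧ ∀ p, v p / v i ∈ ringOfIntegers V.ν := by
  obtain ⟨q, hq⟩ := Function.ne_iff.1 hv
  have : Nonempty (Fin n) := ⟨q⟩
  obtain ⟨i, hi⟩ := Finite.exists_min fun p => V.ν (v p)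
  have hi0 : v i ≠ 0 := by
    intro h0
    have := hi q
    rw [h0, V.ν.map_zero, top_le_iff, V.ν.top_iff] at this
    exact hq this
  refine ⟨i, hi0, fun p => ?_⟩
  have h := hi p
  rw [← div_mul_cancel₀ (v p) hi0, V.ν.map_mul] at h
  rw [mem_ringOfIntegers_iff]
  by_cases hp : v p = 0
  · rw [hp, zero_div, V.ν.map_zero]
    exact le_top
  · rw [V.ν_eq_ord hi0, V.ν_eq_ord (div_ne_zero hp hi0)] at h
    rw [V.ν_eq_ord (div_ne_zero hp hi0)]
    have h' : V.ord (v i) ≤ V.ord (v p / v i) + V.ord (v i) := by exact_mod_cast h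
    exact_mod_cast le_add_iff_nonneg_left _ |>.1 h'

/-- The function `x ↦ g^{0,0}(τx - b) X^δ`. -/
def affineLift {n : ℕ} (g : (Fin n → k) → ℂ) (τ : Matrix (Fin n) (Fin n) F) (b : Fin n → F)
    (δ : Γ) (x : Fin n → F) : CGamma Γ :=
  constC Γ (V.lift g 0 0 (τ.mulVec x - b)) * Xpow δ

theorem lift_mulVec_eq_affineLift {n : ℕ} (g : (Fin n → k) → ℂ) (a : Fin n → F) (γ : Fin n → Γ)
    (δ : Γ) (τ : Matrix (Fin n) (Fin n) F) :
    (fun x => constC Γ (V.lift g a γ (τ.mulVec x)) * Xpow δ) =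
      V.affineLift g (Matrix.diagonal (fun i => V.tF (-γ i)) * τ) (fun i => a i * V.tF (-γ i))
        δ := by
  funext x
  rw [affineLift, lift_eq_lift_zero_zero, ← Matrix.mulVec_mulVec]
  congr 3
  funext i
  simp only [Pi.sub_apply, Matrix.mulVec_diagonal]
  ring

end Lift

/-! ### Integrating out one variable, and induction. -/

variable [NontriviallyNormedField k] [LocallyCompactSpace k] [MeasurableSpace k]
  {V : SplitValuedField F Γ k} {μ : Measure k}

theorem IsStronglyFubini.isFubini {n : ℕ} {f : (Fin n → F) → CGamma Γ}
    (h : V.IsStronglyFubini μ n f) : V.IsFubini μ n f := by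
  cases n with
  | zero => trivial
  | succ n => exact h.1

variable (V) [BorelSpace k] [μ.IsAddHaarMeasure]

/-- Integrating out a variable whose column in the matrix has a single non-zero entry. -/
theorem partialIntegral_affineLift_of_column {n : ℕ} {g : (Fin (n + 1) → k) → ℂ}
    (hg : GLFubini μ (n + 1) g) {A : Matrix (Fin (n + 1)) (Fin (n + 1)) F} {i r : Fin (n + 1)}
    (hA : ∀ p, A (i.succAbove p) r = 0) (hir : A i r ≠ 0) (b : Fin (n + 1) → F) (δ : Γ) :
    (∀ y, V.IsSimple μ fun x => V.affineLift g A b δ (r.insertNth x y)) ∧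
      V.partialIntegral μ r (V.affineLift g A b δ) =
        V.affineLift
          (fun y => ((modulus (V.res (V.unitPart (A i r))) : ℝ) : ℂ)⁻¹ *
            ∫ u, g (i.insertNth u y) ∂μ)
          (A.submatrix i.succAbove r.succAbove) (fun p => b (i.succAbove p))
          (δ - V.ord (A i r)) := by
  have hint : ∀ y, Integrable (fun u => g (i.insertNth u y)) μ := (hg.resFubini.2 i).1
  have key : ∀ y, V.IsSimple μ (fun x => V.affineLift g A b δ (r.insertNth x y)) ∧
      V.integral μ (fun x => V.affineLift g A b δ (r.insertNth x y)) =
        V.affineLift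
          (fun y => ((modulus (V.res (V.unitPart (A i r))) : ℝ) : ℂ)⁻¹ *
            ∫ u, g (i.insertNth u y) ∂μ)
          (A.submatrix i.succAbove r.succAbove) (fun p => b (i.succAbove p))
          (δ - V.ord (A i r)) y := by
    intro y
    simp only [affineLift, mulVec_insertNth_sub hA, V.lift_insertNth]
    rw [lift_zero_zero]
    -- Whether the remaining coordinates are integral does not depend on $x_r$; if they are not, the
    -- whole section is zero.
    by_cases h : ∀ p, ((A.submatrix i.succAbove r.succAbove).mulVec y -
        fun p => b (i.succAbove p)) p ∈ ringOfIntegers V.ν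
    · simp only [if_pos h]
      refine ⟨V.isSimple_lift₁_comp_affine μ (hint _) hir _ δ, ?_⟩
      rw [V.integral_lift₁_comp_affine μ (hint _) hir, V.absF_inv_eq, constC_mul,
        sub_eq_add_neg δ, Xpow_add]
      ring
    · simp only [if_neg h, constC_zero, zero_mul]
      exact ⟨V.isSimple_zero μ, V.integral_zero μ⟩
  exact ⟨fun y => (key y).1, funext fun y => (key y).2⟩

/-- The inductive step: the partial integral has the same shape, and the final equation says that
the expected value of the repeated integral is preserved, whichever variable is chosen. -/
theorem exists_partialIntegral_affineLift {n : ℕ} {g : (Fin (n + 1) → k) → ℂ}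
    (hg : GLFubini μ (n + 1) g) {τ : Matrix (Fin (n + 1)) (Fin (n + 1)) F} (hτ : τ.det ≠ 0)
    (b : Fin (n + 1) → F) (δ : Γ) (r : Fin (n + 1)) :
    (∀ y, V.IsSimple μ fun x => V.affineLift g τ b δ (r.insertNth x y)) ∧
      ∃ (g' : (Fin n → k) → ℂ) (τ' : Matrix (Fin n) (Fin n) F) (b' : Fin n → F) (δ' : Γ),
        GLFubini μ n g' ∧ τ'.det ≠ 0 ∧
        V.partialIntegral μ r (V.affineLift g τ b δ) = V.affineLift g' τ' b' δ' ∧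
        (V.absF τ'.det)⁻¹ * (constC Γ (∫ u, g' u ∂(Measure.pi fun _ => μ)) * Xpow δ') =
          (V.absF τ.det)⁻¹ * (constC Γ (∫ u, g u ∂(Measure.pi fun _ => μ)) * Xpow δ) := by
  obtain ⟨i, hi, hdiv⟩ := V.exists_forall_div_mem (v := fun p => τ p r) (by
    intro h
    exact hτ (Matrix.det_eq_zero_of_column_eq_zero r fun p => congrFun h p))
  -- The multipliers of the row operations clearing column $r$; the zero in place $i$ keeps the
  -- pivot row.
  obtain ⟨c, hc0, hc⟩ : ∃ c : Fin (n + 1) → F, c i = 0 ∧ ∀ p, c (i.succAbove p) =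
      τ (i.succAbove p) r / τ i r :=
    ⟨i.insertNth 0 fun p => τ (i.succAbove p) r / τ i r, by simp, by simp⟩
  have hc' : ∀ p, c p ∈ ringOfIntegers V.ν := by
    intro p
    cases p using Fin.succAboveCases i
    · rw [hc0]; exact zero_mem _
    · rw [hc]; exact hdiv _
  have hres0 : V.res (c i) = 0 := by rw [hc0, res_zero]
  obtain ⟨σ, hσ⟩ := exists_generalLinear_shear i (c := fun p => V.res (c p)) hres0
  have hg₁ := hg.comp_mulVec σ
  simp only [hσ] at hg₁
  set g₁ : (Fin (n + 1) → k) → ℂ := fun u => g fun j => u j + u i * V.res (c j) with hg₁_def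
  set A : Matrix (Fin (n + 1)) (Fin (n + 1)) F := Matrix.of fun p q => τ p q - c p * τ i q with hA
  have hAcol : ∀ p, A (i.succAbove p) r = 0 := by
    intro p
    simp only [hA, Matrix.of_apply, hc]
    rw [div_mul_cancel₀ _ hi, sub_self]
  have hAi : A i r = τ i r := by simp [hA, hc0]
  have hAir : A i r ≠ 0 := hAi ▸ hi
  have hlift : V.affineLift g τ b δ = V.affineLift g₁ A (fun p => b p - b i * c p) δ := by
    funext x
    rw [affineLift, affineLift, V.lift_eq_lift_comp_shear g hc0 hc']
    congr 4
    funext p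
    simp only [hA, Matrix.mulVec, dotProduct, Pi.sub_apply, Matrix.of_apply, sub_mul,
      Finset.sum_sub_distrib, mul_assoc, ← Finset.mul_sum]
    ring
  have hdetA : A.det = τ.det := det_sub_mul_row τ hc0
  have hdet := det_eq_of_column hAcol
  rw [hdetA] at hdet
  have hdet' : (A.submatrix i.succAbove r.succAbove).det ≠ 0 := by
    intro h
    rw [h, mul_zero] at hdet
    exact hτ hdet
  obtain ⟨hs, hp⟩ := V.partialIntegral_affineLift_of_column hg₁ hAcol hAir
    (fun p => b p - b i * c p) δ
  rw [hlift]
  refine ⟨hs, _, _, _, _, (hg₁.integral_insertNth i).const_mul _, hdet', hp, ?_⟩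
  have hint : ∫ u, g₁ u ∂(Measure.pi fun _ => μ) = ∫ u, g u ∂(Measure.pi fun _ => μ) :=
    integral_comp_shear i hres0 hg.resFubini.integrable hg₁.resFubini.integrable
  -- The cofactor sign has absolute value 1 and drops out.
  have hpow : ((-1 : F) ^ (i + r : ℕ)) ≠ 0 := pow_ne_zero _ (by simp)
  rw [integral_const_mul, (integral_integral_insertNth hg₁.resFubini.integrable i).1, hint, hdet,
    V.absF_mul (mul_ne_zero hpow hAir) hdet', V.absF_mul hpow hAir, V.absF_neg_one_pow, one_mul,
    mul_inv, V.absF_inv_eq (α := A i r), constC_mul, sub_eq_add_neg δ, Xpow_add]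
  ring

theorem isStronglyFubini_affineLift {n : ℕ} {g : (Fin n → k) → ℂ} (hg : GLFubini μ n g)
    {τ : Matrix (Fin n) (Fin n) F} (hτ : τ.det ≠ 0) (b : Fin n → F) (δ : Γ) :
    V.IsStronglyFubini μ n (V.affineLift g τ b δ) ∧
      V.repeatedIntegral μ n (V.affineLift g τ b δ) =
        (V.absF τ.det)⁻¹ * (constC Γ (∫ u, g u ∂(Measure.pi fun _ => μ)) * Xpow δ) := by
  induction n generalizing δ with
  | zero =>
    refine ⟨trivial, ?_⟩
    -- On the point the integrality condition is empty, the determinant is 1 and the product measure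
    -- is a Dirac mass.
    rw [repeatedIntegral, affineLift, lift_zero_zero, if_pos (fun i => i.elim0),
      Matrix.det_fin_zero, absF_one, inv_one, one_mul, Measure.pi_of_empty, integral_dirac]
    congr 3
    exact Subsingleton.elim _ _
  | succ n ih =>
    have step : ∀ r, (∀ y, V.IsSimple μ fun x => V.affineLift g τ b δ (r.insertNth x y)) ∧
        V.IsStronglyFubini μ n (V.partialIntegral μ r (V.affineLift g τ b δ)) ∧
        V.repeatedIntegral μ n (V.partialIntegral μ r (V.affineLift g τ b δ)) =
          (V.absF τ.det)⁻¹ * (constC Γ (∫ u, g u ∂(Measure.pi fun _ => μ)) * Xpow δ) := by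
      intro r
      obtain ⟨hs, g', τ', b', δ', hg', hτ', hp, he⟩ :=
        V.exists_partialIntegral_affineLift hg hτ b δ r
      rw [hp, ← he]
      exact ⟨hs, ih hg' hτ' b' δ'⟩
    refine ⟨⟨⟨fun r => ⟨fun y => Submodule.subset_span ((step r).1 y), ?_⟩, fun r s => ?_⟩,
      fun r => ⟨(step r).1, (step r).2.1⟩⟩, (step 0).2.2⟩
    · exact IsStronglyFubini.isFubini (step r).2.1
    · rw [(step r).2.2, (step s).2.2]

end SplitValuedField

theorem mainTheorem2 {F Γ k : Type*} [Field F]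
    [AddCommGroup Γ] [LinearOrder Γ] [IsOrderedAddMonoid Γ]
    [NontriviallyNormedField k] [LocallyCompactSpace k] [MeasurableSpace k] [BorelSpace k]
    (V : SplitValuedField F Γ k) (μ : MeasureTheory.Measure k) [μ.IsAddHaarMeasure]
    (n : ℕ) (hn : 0 < n) (g : (Fin n → k) → ℂ) (hg : GLFubini μ n g)
    (a : Fin n → F) (γ : Fin n → Γ) (δ : Γ)
    (f : (Fin n → F) → CGamma Γ)
    (hf : f = fun x => constC Γ (V.lift g a γ x) * Xpow δ)
    (τ : GL (Fin n) F) :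
    V.IsStronglyFubini μ n (fun x => f ((τ : Matrix (Fin n) (Fin n) F).mulVec x)) ∧
      V.repeatedIntegral μ n (fun x => f ((τ : Matrix (Fin n) (Fin n) F).mulVec x)) =
        (V.absF (τ : Matrix (Fin n) (Fin n) F).det)⁻¹ * V.repeatedIntegral μ n f := by
  subst hf
  have hτ : (τ : Matrix (Fin n) (Fin n) F).det ≠ 0 :=
    ((Matrix.isUnit_iff_isUnit_det _).1 τ.isUnit).ne_zero
  have hD : (Matrix.diagonal fun i => V.tF (-γ i)).det ≠ 0 := by
    rw [Matrix.det_diagonal]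
    exact Finset.prod_ne_zero_iff.2 fun i _ => V.tF_ne_zero _
  -- The function $f$ itself is the case of the identity matrix, so both integrals come from one
  -- formula and the factor from the diagonal scaling is common to them.
  have h1 := V.lift_mulVec_eq_affineLift g a γ δ 1
  simp only [Matrix.one_mulVec, mul_one] at h1
  have hDτ : (Matrix.diagonal (fun i => V.tF (-γ i)) * (τ : Matrix (Fin n) (Fin n) F)).det ≠ 0 := by
    rw [Matrix.det_mul]
    exact mul_ne_zero hD hτ
  obtain ⟨hs, hi⟩ := V.isStronglyFubini_affineLift hg hDτ (fun i => a i * V.tF (-γ i)) δ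
  rw [V.lift_mulVec_eq_affineLift g a γ δ τ, h1]
  refine ⟨hs, ?_⟩
  rw [hi, (V.isStronglyFubini_affineLift hg hD _ δ).2, Matrix.det_mul, V.absF_mul hD hτ, mul_inv]
  ring

end
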